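/- Let $V$ be a non-empty countable set with non-negative weights $r_{\{x,y\}}$, $x,y\in V$, such that the pairs $\{x,y\}$ with $r_{\{x,y\}}>0$ are the edges of a locally finite tree on $V$. Let $X$ be the random walk on this weighted tree: the Markov chain on $V$ which from $x$ moves to a neighbour $y$ with probability proportional to the conductance $1/r_{\{x,y\}}$ (if $V$ has a single vertex, $X$ is constant). It is called recurrent if, started from any vertex, it returns there almost surely, and transient if, started from any vertex, it has positive probability never to return there. Fix a root $\rho\in V$. A direction is a sequence $x=(x_n)_{n\ge 0}$ of distinct vertices with $x_0=\rho$ and $r_{\{x_n,x_{n+1}\}}>0$ for all $n\ge 0$; let $\tilde E_\infty$ be the set of directions. For directions $x\ne y$ let $k(x,y)$ be the last index $k$ with $x_k=y_k$, and equip $\tilde E_\infty$ with the metric $$\tilde r(x,y)=\min\Big\{1,\Big(\sum_{i<k(x,y)} r_{\{x_i,x_{i+1}\}}\Big)^{-1}\Big\}\quad (x\neq y),\qquad \tilde r(x,x)=0,$$ where $0^{-1}=\infty$; the sum is the distance from $\rho$ to the vertex $x_{k(x,y)}$ in the tree with edge lengths $r$. Suppose that $\sum_{n\ge 0} r_{\{x_n,x_{n+1}\}}=\infty$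 for every direction $x$. Then: 1. If the one-dimensional Hausdorff measure $\mathcal H^1$ on $(\tilde E_\infty,\tilde r)$ is finite, then $X$ is recurrent. 2. If the Hausdorff dimension $\dim_{\mathrm H}(\tilde E_\infty,\tilde r)$ is greater than $1$, then $X$ is transient. -/

import Mathlib

open MeasureTheory ProbabilityTheory
open scoped ENNReal NNReal

/-- The graph on `V` whose edges are the pairs `{x, y}` of distinct vertices carrying a strictly
positive weight. -/
def weightGraph {V : Type*} (r : Sym2 V → ℝ≥0) : SimpleGraph V where
  Adj x y := x ≠ y ∧ 0 < r s(x, y)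
  symm := ⟨fun x y h => ⟨h.1.symm, by rw [Sym2.eq_swap]; exact h.2⟩⟩
  loopless := ⟨fun _ h => h.1 rfl⟩

/-- A weighted discrete tree on the vertex set `V`: nonnegative weights (resistances) `r {x, y}`,
such that the pairs of positive weight are the edges of a locally finite tree (in particular there
are no loops). -/
structure WeightedTree (V : Type*) where
  r : Sym2 V → ℝ≥0
  r_diag : ∀ x, r s(x, x) = 0
  isTree : (weightGraph r).IsTree
  locallyFinite : ∀ x, ((weightGraph r).neighborSet x).Finite

namespace WeightedTree

variable {V : Type*} (T : WeightedTree V)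

/-! ### The random walk -/

/-- The conductance `c {x, y} = (r {x, y})⁻¹` of an edge `{x, y}`. For a pair that is not an edge
the weight is `0`, and so is the conductance (as `0⁻¹ = 0` in `ℝ≥0`). -/
noncomputable def conductance (x y : V) : ℝ≥0∞ := ((T.r s(x, y))⁻¹ : ℝ≥0)

theorem tsum_conductance_ne_top (x : V) : ∑' y, T.conductance x y ≠ ∞ := by
  have h : ∀ y ∉ (T.locallyFinite x).toFinset, T.conductance x y = 0 := by
    intro y hy
    have h0 : T.r s(x, y) = 0 := by
      by_contra hne
      apply hy
      simp only [Set.Finite.mem_toFinset, SimpleGraph.mem_neighborSet]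
      refine ⟨?_, pos_iff_ne_zero.2 hne⟩
      rintro rfl
      exact hne (T.r_diag x)
    simp [conductance, h0]
  rw [tsum_eq_sum h]
  exact ENNReal.sum_ne_top.2 fun _ _ => ENNReal.coe_ne_top

open Classical in
/-- The law of one step of the walk from `x`: the neighbour `y` is chosen with probability
proportional to `c {x, y}`. A vertex without neighbours, which exists only in the tree with a single
vertex, is never left. -/
noncomputable def stepDist (x : V) : PMF V :=
  if h : ∑' y, T.conductance x y = 0 then PMF.pure x
  else PMF.normalize (T.conductance x) h (T.tsum_conductance_ne_top x)

section Walk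

variable [Countable V] [MeasurableSpace V] [DiscreteMeasurableSpace V]

/-- The one-step transition kernel of the walk. -/
noncomputable def stepKernel : Kernel V V where
  toFun x := (T.stepDist x).toMeasure
  measurable' := measurable_of_countable _

instance : IsMarkovKernel T.stepKernel :=
  ⟨fun x => PMF.toMeasure.isProbabilityMeasure (T.stepDist x)⟩

/-- The law of the position at time `n + 1` given the trajectory up to time `n`: it is the law of one
step of the walk from the position at time `n`. -/
noncomputable def historyKernel (n : ℕ) : Kernel (Finset.Iic n → V) V :=
  T.stepKernel.comap (fun w => w ⟨n, Finset.mem_Iic.2 le_rfl⟩) (measurable_pi_apply _)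

instance (n : ℕ) : IsMarkovKernel (T.historyKernel n) := by
  unfold historyKernel; infer_instance

/-- The law on trajectories `ℕ → V` of the random walk on the weighted tree started in `x`, that is,
of the Markov chain with initial state `x` (the trajectory up to time `0` is constantly `x`) and
transition probabilities `stepDist`. -/
noncomputable def walkLaw (x : V) : Measure (ℕ → V) :=
  Kernel.traj (X := fun _ => V) T.historyKernel 0 (fun _ => x)

/-- The walk is recurrent: from every starting vertex it returns there almost surely. -/
def IsRecurrent : Prop := ∀ x, T.walkLaw x {w | ∃ n, 1 ≤ n ∧ w n = x} = 1

/-- The walk is transient: from every starting vertex it has positive probability never to return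
there. -/
def IsTransient : Prop := ∀ x, T.walkLaw x {w | ∃ n, 1 ≤ n ∧ w n = x} < 1

end Walk

/-! ### The space of directions -/

/-- A direction from the root `ρ`: an infinite sequence of distinct vertices starting in `ρ` in which
consecutive vertices are joined by an edge. -/
structure Direction (ρ : V) where
  vertex : ℕ → V
  zero : vertex 0 = ρ
  injective : Function.Injective vertex
  edge : ∀ n, 0 < T.r s(vertex n, vertex (n + 1))

namespace Direction

variable {T} {ρ : V}

@[ext] theorem ext {x y : T.Direction ρ} (h : ∀ n, x.vertex n = y.vertex n) : x = y := by
  cases x; cases y; congr; exact funext h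

/-- The sum of the first `n` edge weights along the direction `x`. As `x` is a self-avoiding path
from the root, this is the tree distance `r(ρ, x n)` given by the edge weights. -/
noncomputable def height (x : T.Direction ρ) (n : ℕ) : ℝ≥0∞ :=
  ∑ i ∈ Finset.range n, (T.r s(x.vertex i, x.vertex (i + 1)) : ℝ≥0∞)

/-- The total resistance along a direction. -/
noncomputable def totalResistance (x : T.Direction ρ) : ℝ≥0∞ :=
  ∑' i, (T.r s(x.vertex i, x.vertex (i + 1)) : ℝ≥0∞)

/-- For `x ≠ y`, the last index at which the directions `x` and `y` agree; the greatest common lower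
bound of `x` and `y` is the vertex of `x` (and of `y`) at this index. -/
noncomputable def meetIndex (x y : T.Direction ρ) : ℕ := sSup {k | x.vertex k = y.vertex k}

theorem meetIndex_comm (x y : T.Direction ρ) : meetIndex x y = meetIndex y x := by
  simp only [meetIndex, eq_comm]

theorem exists_path (x : T.Direction ρ) (k : ℕ) :
    ∃ p : (weightGraph T.r).Walk ρ (x.vertex k),
      p.support = (List.range (k + 1)).map x.vertex := by
  induction k with
  | zero =>
    refine ⟨SimpleGraph.Walk.nil.copy rfl x.zero.symm, ?_⟩
    simp [x.zero]
  | succ k ih =>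
    obtain ⟨p, hp⟩ := ih
    have hadj : (weightGraph T.r).Adj (x.vertex k) (x.vertex (k + 1)) :=
      ⟨fun h => by simpa using x.injective h, x.edge k⟩
    refine ⟨p.concat hadj, ?_⟩
    rw [SimpleGraph.Walk.support_concat, hp, List.range_succ (n := k + 1), List.map_append]
    simp

/-- Two directions that agree at time `k` agree at all earlier times. -/
theorem agree_of_le {x y : T.Direction ρ} {k : ℕ} (h : x.vertex k = y.vertex k) {j : ℕ}
    (hj : j ≤ k) : x.vertex j = y.vertex j := by
  obtain ⟨p, hp⟩ := x.exists_path k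
  obtain ⟨q, hq⟩ := y.exists_path k
  have hp' : p.IsPath := by
    rw [SimpleGraph.Walk.isPath_def, hp]
    exact List.Nodup.map x.injective List.nodup_range
  have hq' : (q.copy rfl h.symm).IsPath := by
    rw [SimpleGraph.Walk.isPath_def, SimpleGraph.Walk.support_copy, hq]
    exact List.Nodup.map y.injective List.nodup_range
  have he := (T.isTree.existsUnique_path _ _).unique hp' hq'
  have hs : (List.range (k + 1)).map x.vertex = (List.range (k + 1)).map y.vertex := by
    rw [← hp, ← hq, he, SimpleGraph.Walk.support_copy]
  exact List.map_inj_left.1 hs j (List.mem_range.2 (by omega))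

theorem bddAbove_agree {x y : T.Direction ρ} (h : x ≠ y) :
    BddAbove {k | x.vertex k = y.vertex k} := by
  obtain ⟨j, hj⟩ : ∃ j, x.vertex j ≠ y.vertex j := by
    by_contra! hc
    exact h (ext hc)
  refine ⟨j, fun k hk => ?_⟩
  by_contra! hlt
  exact hj (agree_of_le hk hlt.le)

theorem vertex_meetIndex {x y : T.Direction ρ} (h : x ≠ y) :
    x.vertex (meetIndex x y) = y.vertex (meetIndex x y) :=
  Nat.sSup_mem (s := {k | x.vertex k = y.vertex k}) ⟨0, by simp [x.zero, y.zero]⟩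
    (bddAbove_agree h)

theorem le_meetIndex {x y : T.Direction ρ} (h : x ≠ y) {k : ℕ} (hk : x.vertex k = y.vertex k) :
    k ≤ meetIndex x y :=
  le_csSup (bddAbove_agree h) hk

theorem height_mono (x : T.Direction ρ) : Monotone x.height := fun _ _ h =>
  Finset.sum_le_sum_of_subset (Finset.range_mono h)

theorem height_eq {x y : T.Direction ρ} {k : ℕ} (h : x.vertex k = y.vertex k) :
    x.height k = y.height k := by
  refine Finset.sum_congr rfl fun i hi => ?_
  have hi' := Finset.mem_range.1 hi
  rw [agree_of_le h hi'.le, agree_of_le h (Nat.succ_le_of_lt hi')]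

open Classical in
/-- The distance `min (1 / r(ρ, x ∧ y)) 1` of two directions `x ≠ y` (it is `1` if `x ∧ y = ρ`). -/
noncomputable instance : EDist (T.Direction ρ) where
  edist x y := if x = y then 0 else min (x.height (meetIndex x y))⁻¹ 1

theorem edist_of_ne {x y : T.Direction ρ} (h : x ≠ y) :
    edist x y = min (x.height (meetIndex x y))⁻¹ 1 := if_neg h

theorem edist_self' (x : T.Direction ρ) : edist x x = 0 := if_pos rfl

theorem edist_comm' (x y : T.Direction ρ) : edist x y = edist y x := by
  by_cases h : x = y
  · rw [h]
  · rw [edist_of_ne h, edist_of_ne (Ne.symm h), height_eq (vertex_meetIndex h), meetIndex_comm]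

theorem edist_le_max (x y z : T.Direction ρ) : edist x z ≤ max (edist x y) (edist y z) := by
  by_cases hxz : x = z
  · rw [hxz, edist_self']; exact zero_le
  by_cases hxy : x = y
  · rw [hxy]; exact le_max_right _ _
  by_cases hyz : y = z
  · rw [hyz]; exact le_max_left _ _
  rw [edist_of_ne hxz, edist_of_ne hxy, edist_of_ne hyz]
  rcases le_total (meetIndex x y) (meetIndex y z) with hle | hle
  · refine le_max_of_le_left (min_le_min_right _ (ENNReal.inv_le_inv.2 (x.height_mono ?_)))
    exact le_meetIndex hxz ((vertex_meetIndex hxy).trans (agree_of_le (vertex_meetIndex hyz) hle))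
  · have hk := agree_of_le (vertex_meetIndex hxy) hle
    refine le_max_of_le_right (min_le_min_right _ (ENNReal.inv_le_inv.2 ?_))
    rw [← height_eq hk]
    exact x.height_mono (le_meetIndex hxz (hk.trans (vertex_meetIndex hyz)))

theorem eq_of_edist_eq_zero' {x y : T.Direction ρ} (h : edist x y = 0) : x = y := by
  by_contra hne
  have hfin : x.height (meetIndex x y) ≠ ∞ :=
    ENNReal.sum_ne_top.2 fun _ _ => ENNReal.coe_ne_top
  rw [edist_of_ne hne] at h
  rcases min_eq_iff.1 h with h | h
  · exact hfin (ENNReal.inv_eq_zero.1 h.1)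
  · exact one_ne_zero h.1

noncomputable instance : EMetricSpace (T.Direction ρ) where
  edist_self := edist_self'
  edist_comm := edist_comm'
  edist_triangle x y z := (edist_le_max x y z).trans (max_le_add_of_nonneg zero_le zero_le)
  eq_of_edist_eq_zero := eq_of_edist_eq_zero'

noncomputable instance : MeasurableSpace (T.Direction ρ) := borel _

instance : BorelSpace (T.Direction ρ) := ⟨rfl⟩

end Direction

end WeightedTree

/-!
The walk is studied through the probability `avoidAlways x v` of never visiting `x` from `v`. It is
the largest function with values in `[0, 1]` that vanishes at `x` and is subharmonic elsewhere
(`le_avoidAlways`), and the walk started in `x` returns almost surely exactly if the one-step average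
of this function vanishes at `x` (`isRecurrent_iff`, `isTransient_iff`). Bounded subharmonic functions
are constant as soon as one vertex is recurrent (`const_of_subharmonic`), so that only the walk started
in the root `ρ` matters. Write `h v` for the distance `rootDist ρ v` from the root.

*Recurrence.* The gradient of `avoidAlways ρ` is a flow `θ` from the root to the space of directions.
As `θ` decreases along a direction `x` while `∑ r θ ≤ 1` along `x` and `h → ∞`, one has `h θ → 0`
along *every* direction (`tendsto_mul_of_bounded_sum`). The flow generates an outer measure on the
space of directions whose total mass is at least the strength of the flow
(`flow_root_le_flowMeasure`, a form of "max flow ≤ min cut" for countable cuts). On the part of the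
space where `h θ ≤ δ` beyond height `N`, this outer measure is at most `δ * ℋ¹`; these parts are Borel
sets exhausting the space, so the strength of the flow is at most `δ * ℋ¹` of the whole space, for all
`δ > 0` (`flow_root_le_hausdorff`). If `ℋ¹` is finite, the flow is zero and the root is recurrent.

*Transience.* Let `d > 1` with `ℋᵈ > 0`, and let `θ v` be the `d`-dimensional Hausdorff content of the
set of directions through `v`. It is positive at the root, satisfies `θ v ≤ ∑ θ c` over the children
`c` of `v` by subadditivity, and is at most `min (1 / h v) 1 ^ d`. Hence the function with gradient `θ`
is subharmonic away from the root, and it is bounded because `∫ min (1 / t) 1 ^ d dt < ∞`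
(`pathSum_le`). After scaling it is a lower bound for `avoidAlways ρ`
(`escape_pos_of_hausdorffMeasure_ne_zero`). Neither direction needs the energy of a flow.
-/

namespace WeightedTree

open Filter Topology

variable {V : Type*} (T : WeightedTree V)

/-! ### Potential theory of the walk -/

/-- The finite set of neighbours of a vertex. -/
noncomputable def nbr (v : V) : Finset V := (T.locallyFinite v).toFinset

/-- The conductance of the pair `{v, y}` as a real number. -/
noncomputable def cond (v y : V) : ℝ := (T.r s(v, y) : ℝ)⁻¹

/-- The sum of the conductances at a vertex. -/
noncomputable def tot (v : V) : ℝ := ∑ y ∈ T.nbr v, T.cond v y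

/-- The unnormalised graph Laplacian: the net current into `v` under the potential `u`. -/
noncomputable def lap (u : V → ℝ) (v : V) : ℝ := ∑ y ∈ T.nbr v, T.cond v y * (u y - u v)

/-- The expectation of `u` after one step of the walk from `v`. At a vertex without neighbours
`tot v = 0`, and the value is `u v`, as it should be since the walk stays there. -/
noncomputable def avg (u : V → ℝ) (v : V) : ℝ := u v + (T.tot v)⁻¹ * T.lap u v

variable {T}

theorem mem_nbr {v y : V} : y ∈ T.nbr v ↔ (weightGraph T.r).Adj v y := by
  simp [nbr]

theorem r_pos_of_mem {v y : V} (h : y ∈ T.nbr v) : 0 < (T.r s(v, y) : ℝ) := (mem_nbr.1 h).2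

theorem cond_pos {v y : V} (h : y ∈ T.nbr v) : 0 < T.cond v y := inv_pos.2 (r_pos_of_mem h)

theorem cond_nonneg (v y : V) : 0 ≤ T.cond v y := inv_nonneg.2 NNReal.zero_le_coe

theorem tot_nonneg (v : V) : 0 ≤ T.tot v := Finset.sum_nonneg fun _ _ => cond_nonneg _ _

theorem tot_pos_iff {v : V} : 0 < T.tot v ↔ (T.nbr v).Nonempty := by
  constructor
  · intro h
    by_contra hne
    rw [Finset.not_nonempty_iff_eq_empty] at hne
    simp [tot, hne] at h
  · exact fun h => Finset.sum_pos (fun _ hy => cond_pos hy) h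

theorem avg_of_isolated {v : V} (h : ¬ (T.nbr v).Nonempty) (u : V → ℝ) : T.avg u v = u v := by
  rw [Finset.not_nonempty_iff_eq_empty] at h
  simp [avg, lap, h]

theorem avg_eq {v : V} (h : (T.nbr v).Nonempty) (u : V → ℝ) :
    T.avg u v = ∑ y ∈ T.nbr v, T.cond v y / T.tot v * u y := by
  have h0 := (tot_pos_iff.2 h).ne'
  have : T.lap u v = ∑ y ∈ T.nbr v, T.cond v y * u y - T.tot v * u v := by
    simp only [lap, mul_sub, Finset.sum_sub_distrib, tot, Finset.sum_mul]
  rw [avg, this]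
  simp_rw [div_mul_eq_mul_div, ← Finset.sum_div]
  field_simp
  ring

theorem le_avg_iff {u : V → ℝ} {v : V} : u v ≤ T.avg u v ↔ 0 ≤ T.lap u v := by
  by_cases h : (T.nbr v).Nonempty
  · rw [avg, le_add_iff_nonneg_right, mul_nonneg_iff_of_pos_left (inv_pos.2 (tot_pos_iff.2 h))]
  · rw [avg_of_isolated h]
    rw [Finset.not_nonempty_iff_eq_empty] at h
    simp [lap, h]

theorem eq_avg_iff {u : V → ℝ} {v : V} : u v = T.avg u v ↔ T.lap u v = 0 := by
  by_cases h : (T.nbr v).Nonempty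
  · simp [avg, (tot_pos_iff.2 h).ne']
  · rw [avg_of_isolated h]
    rw [Finset.not_nonempty_iff_eq_empty] at h
    simp [lap, h]

theorem avg_mono {u w : V → ℝ} (h : ∀ v, u v ≤ w v) (v : V) : T.avg u v ≤ T.avg w v := by
  by_cases hv : (T.nbr v).Nonempty
  · rw [avg_eq hv, avg_eq hv]
    exact Finset.sum_le_sum fun y _ =>
      mul_le_mul_of_nonneg_left (h y) (div_nonneg (cond_nonneg _ _) (tot_nonneg _))
  · rw [avg_of_isolated hv, avg_of_isolated hv]; exact h v

theorem avg_const_sub (a : ℝ) (u : V → ℝ) (v : V) :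
    T.avg (fun y => a - u y) v = a - T.avg u v := by
  have : T.lap (fun y => a - u y) v = - T.lap u v := by
    rw [lap, lap, ← Finset.sum_neg_distrib]
    exact Finset.sum_congr rfl fun _ _ => by ring
  rw [avg, avg, this]; ring

theorem avg_const (a : ℝ) (v : V) : T.avg (fun _ => a) v = a := by
  simp [avg, lap]

theorem avg_nonneg {u : V → ℝ} (h : ∀ v, 0 ≤ u v) (v : V) : 0 ≤ T.avg u v := by
  simpa [avg_const] using avg_mono (T := T) (u := fun _ => 0) h v

theorem tendsto_avg {u : ℕ → V → ℝ} {w : V → ℝ}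
    (h : ∀ v, Tendsto (fun n => u n v) atTop (𝓝 (w v))) (v : V) :
    Tendsto (fun n => T.avg (u n) v) atTop (𝓝 (T.avg w v)) := by
  simp only [avg, lap]
  exact (h v).add ((tendsto_finsetSum _ fun y _ => ((h y).sub (h v)).const_mul _).const_mul _)

/-- The strong minimum principle. -/
theorem eq_zero_of_avg_le {u : V → ℝ} (h0 : ∀ v, 0 ≤ u v) (hu : ∀ v, T.avg u v ≤ u v) {x : V}
    (hx : u x = 0) (v : V) : u v = 0 := by
  have step : ∀ a b : V, (weightGraph T.r).Adj a b → u a = 0 → u b = 0 := by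
    intro a b hab ha
    have hb := mem_nbr.2 hab
    have h1 := hu a
    rw [avg_eq ⟨b, hb⟩, ha] at h1
    have h2 := (Finset.sum_eq_zero_iff_of_nonneg (fun y _ => mul_nonneg
      (div_nonneg (cond_nonneg a y) (tot_nonneg a)) (h0 y))).1
      (le_antisymm h1 (Finset.sum_nonneg fun y _ => mul_nonneg
      (div_nonneg (cond_nonneg a y) (tot_nonneg a)) (h0 y))) b hb
    exact (mul_eq_zero.1 h2).resolve_left
      (div_pos (cond_pos hb) (tot_pos_iff.2 ⟨b, hb⟩)).ne'
  obtain ⟨p⟩ := T.isTree.connected x v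
  induction p with
  | nil => exact hx
  | cons hab _ ih => exact ih (step _ _ hab hx)

variable (T)

open Classical in
/-- `T.avoid x n v` is the probability that the walk started in `v` avoids `x` at the times
`0, …, n`, defined by a first-step recursion. -/
noncomputable def avoid (x : V) : ℕ → V → ℝ
  | 0 => fun v => if v = x then 0 else 1
  | n + 1 => fun v => if v = x then 0 else T.avg (avoid x n) v

/-- The probability that the walk started in `v` never visits `x`. -/
noncomputable def avoidAlways (x v : V) : ℝ := ⨅ n, T.avoid x n v

variable {T}

theorem avoid_self (x : V) (n : ℕ) : T.avoid x n x = 0 := by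
  cases n <;> simp [avoid]

theorem avoid_succ {x v : V} (h : v ≠ x) (n : ℕ) :
    T.avoid x (n + 1) v = T.avg (T.avoid x n) v := if_neg h

theorem avoid_nonneg (x : V) (n : ℕ) (v : V) : 0 ≤ T.avoid x n v := by
  induction n generalizing v with
  | zero => simp only [avoid]; split_ifs <;> norm_num
  | succ n ih =>
    by_cases h : v = x
    · rw [h, avoid_self]
    · rw [avoid_succ h]; exact avg_nonneg ih v

theorem avoid_le_one (x : V) (n : ℕ) (v : V) : T.avoid x n v ≤ 1 := by
  induction n generalizing v with
  | zero => simp only [avoid]; split_ifs <;> norm_num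
  | succ n ih =>
    by_cases h : v = x
    · rw [h, avoid_self]; exact zero_le_one
    · rw [avoid_succ h]; simpa [avg_const] using avg_mono (w := fun _ => 1) ih v

theorem avoid_succ_le (x : V) (n : ℕ) (v : V) : T.avoid x (n + 1) v ≤ T.avoid x n v := by
  induction n generalizing v with
  | zero =>
    by_cases h : v = x
    · rw [h, avoid_self, avoid_self]
    · have : T.avoid x 0 v = 1 := if_neg h
      rw [this]; exact avoid_le_one _ _ _
  | succ n ih =>
    by_cases h : v = x
    · rw [h, avoid_self, avoid_self]
    · rw [avoid_succ h, avoid_succ h]; exact avg_mono ih v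

theorem tendsto_avoid (x v : V) :
    Tendsto (fun n => T.avoid x n v) atTop (𝓝 (T.avoidAlways x v)) :=
  tendsto_atTop_ciInf (antitone_nat_of_succ_le fun n => avoid_succ_le x n v)
    ⟨0, by rintro _ ⟨n, rfl⟩; exact avoid_nonneg _ _ _⟩

theorem avoidAlways_self (x : V) : T.avoidAlways x x = 0 := by
  simp [avoidAlways, avoid_self]

theorem avoidAlways_nonneg (x v : V) : 0 ≤ T.avoidAlways x v :=
  le_ciInf fun n => avoid_nonneg x n v

theorem avoidAlways_le_one (x v : V) : T.avoidAlways x v ≤ 1 :=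
  le_of_tendsto' (tendsto_avoid x v) fun n => avoid_le_one x n v

theorem avoidAlways_eq_avg {x v : V} (h : v ≠ x) :
    T.avoidAlways x v = T.avg (T.avoidAlways x) v := by
  refine tendsto_nhds_unique ((tendsto_avoid x v).comp (tendsto_add_atTop_nat 1)) ?_
  refine (tendsto_avg (tendsto_avoid x) v).congr fun n => ?_
  exact (avoid_succ h n).symm

theorem avoidAlways_le_avg (x v : V) : T.avoidAlways x v ≤ T.avg (T.avoidAlways x) v := by
  by_cases h : v = x
  · rw [h, avoidAlways_self]; exact avg_nonneg (avoidAlways_nonneg x) x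
  · exact (avoidAlways_eq_avg h).le

/-- The avoidance probability is the largest function with values in `[0, 1]` that vanishes at `x`
and is subharmonic elsewhere. -/
theorem le_avoidAlways {u : V → ℝ} {x : V} (h1 : ∀ v, u v ≤ 1) (hx : u x = 0)
    (hu : ∀ v, v ≠ x → u v ≤ T.avg u v) (v : V) : u v ≤ T.avoidAlways x v := by
  refine le_ciInf fun n => ?_
  induction n generalizing v with
  | zero =>
    by_cases h : v = x
    · rw [h, hx, avoid_self]
    · exact (h1 v).trans_eq (if_neg h).symm
  | succ n ih =>
    by_cases h : v = x
    · rw [h, hx, avoid_self]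
    · rw [avoid_succ h]; exact (hu v h).trans (avg_mono ih v)

/-- If the walk never escapes from `ρ`, then bounded subharmonic functions are constant. -/
theorem const_of_subharmonic {ρ : V} (hρ : T.avg (T.avoidAlways ρ) ρ ≤ 0) {u : V → ℝ}
    (h0 : ∀ v, 0 ≤ u v) (h1 : ∀ v, u v ≤ 1) (hu : ∀ v, u v ≤ T.avg u v) (v : V) : u v = u ρ := by
  have hz : ∀ v, T.avoidAlways ρ v = 0 := by
    refine eq_zero_of_avg_le (T := T) (avoidAlways_nonneg ρ) (fun v => ?_) (avoidAlways_self ρ)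
    by_cases h : v = ρ
    · rw [h, avoidAlways_self]; exact hρ
    · exact (avoidAlways_eq_avg h).ge
  have hle : ∀ v, u v ≤ u ρ := by
    intro v
    -- The positive part of `u - u ρ` is subharmonic and vanishes at `ρ`.
    have key := le_avoidAlways (T := T) (x := ρ) (u := fun v => max (u v - u ρ) 0)
      (fun v => max_le (by linarith [h1 v, h0 ρ]) zero_le_one) (by simp) (fun v _ => ?_) v
    · rw [hz] at key
      linarith [le_max_left (u v - u ρ) 0]
    · have e : T.avg (fun y => u y - u ρ) v = T.avg u v - u ρ := by
        have := avg_const_sub (T := T) (-u ρ) (fun y => -u y) v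
        have h2 := avg_const_sub (T := T) 0 u v
        simp only [zero_sub] at h2
        rw [h2] at this
        simp only [sub_neg_eq_add] at this
        rw [show (fun y => u y - u ρ) = fun y => -u ρ + u y by ext; ring, this]; ring
      refine max_le ?_ (avg_nonneg (fun _ => le_max_right _ _) v)
      calc u v - u ρ ≤ T.avg (fun y => u y - u ρ) v := by rw [e]; linarith [hu v]
        _ ≤ _ := avg_mono (fun y => le_max_left _ _) v
  -- So `u` has its maximum at `ρ`, and the minimum principle applies to `u ρ - u`.
  have := eq_zero_of_avg_le (T := T) (u := fun y => u ρ - u y) (x := ρ)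
    (fun v => by linarith [hle v]) (fun v => by rw [avg_const_sub]; linarith [hu v]) (by simp) v
  linarith

/-- Escaping with positive probability does not depend on the starting vertex. -/
theorem escape_pos_of_escape_pos {x : V} (hx : 0 < T.avg (T.avoidAlways x) x) (ρ : V) :
    0 < T.avg (T.avoidAlways ρ) ρ := by
  by_contra! hρ
  have hc := const_of_subharmonic hρ (avoidAlways_nonneg x) (avoidAlways_le_one x)
    (avoidAlways_le_avg x)
  have : T.avoidAlways x = fun _ => 0 := by
    ext v; rw [hc v, ← hc x, avoidAlways_self]
  rw [this, avg_const] at hx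
  exact lt_irrefl _ hx

end WeightedTree

namespace WeightedTree

open Filter Topology

variable {V : Type*} {T : WeightedTree V}

/-! ### Return probabilities -/

theorem conductance_eq_ofReal (v y : V) : T.conductance v y = ENNReal.ofReal (T.cond v y) := by
  rw [conductance, cond, ← NNReal.coe_inv, ENNReal.ofReal_coe_nnreal]

theorem cond_eq_zero {v y : V} (h : y ∉ T.nbr v) : T.cond v y = 0 := by
  have h0 : T.r s(v, y) = 0 := by
    by_contra hne
    refine h (mem_nbr.2 ⟨?_, pos_iff_ne_zero.2 hne⟩)
    rintro rfl
    exact hne (T.r_diag v)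
  simp [cond, h0]

theorem tsum_conductance (v : V) : ∑' y, T.conductance v y = ENNReal.ofReal (T.tot v) := by
  rw [tot, ENNReal.ofReal_sum_of_nonneg fun _ _ => cond_nonneg _ _]
  simp_rw [conductance_eq_ofReal]
  exact tsum_eq_sum fun y hy => by rw [cond_eq_zero (T := T) (v := v) hy, ENNReal.ofReal_zero]

open Classical in
/-- One step of the walk killed at `x`. -/
noncomputable def killedAvg (T : WeightedTree V) (x : V) (u : V → ℝ) : V → ℝ :=
  T.avg fun v => if v = x then 0 else u v

theorem killedAvg_nonneg {x : V} {u : V → ℝ} (hu : ∀ v, 0 ≤ u v) (v : V) :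
    0 ≤ killedAvg T x u v :=
  avg_nonneg (fun v => by split_ifs <;> [exact le_rfl; exact hu v]) v

theorem iterate_killedAvg_one (x : V) (n : ℕ) (v : V) :
    (killedAvg T x)^[n + 1] (fun _ => 1) v = T.avg (T.avoid x n) v := by
  induction n generalizing v with
  | zero => rfl
  | succ n ih =>
    rw [Function.iterate_succ_apply']
    unfold killedAvg
    congr 1
    ext y
    simp only [avoid]
    split_ifs with h
    · rfl
    · exact ih y

section

variable [Countable V] [MeasurableSpace V] [DiscreteMeasurableSpace V]

theorem lintegral_stepDist {u : V → ℝ} (hu : ∀ v, 0 ≤ u v) (v : V) :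
    ∫⁻ y, ENNReal.ofReal (u y) ∂(T.stepDist v).toMeasure = ENNReal.ofReal (T.avg u v) := by
  by_cases h : (T.nbr v).Nonempty
  · have htot := tot_pos_iff.2 h
    have h0 : ∑' y, T.conductance v y ≠ 0 := by
      rw [tsum_conductance]; simpa using htot
    rw [lintegral_countable', stepDist, dif_neg h0, avg_eq h,
      ENNReal.ofReal_sum_of_nonneg fun y _ =>
        mul_nonneg (div_nonneg (cond_nonneg _ _) htot.le) (hu y)]
    simp_rw [PMF.toMeasure_apply_singleton _ _ (measurableSet_singleton _), PMF.normalize_apply,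
      tsum_conductance, conductance_eq_ofReal]
    rw [tsum_eq_sum fun y hy => by simp [cond_eq_zero (T := T) (v := v) hy]]
    refine Finset.sum_congr rfl fun y _ => ?_
    rw [mul_comm, ENNReal.ofReal_mul (div_nonneg (cond_nonneg _ _) htot.le),
      ENNReal.ofReal_div_of_pos htot, div_eq_mul_inv]
  · have h0 : ∑' y, T.conductance v y = 0 := by
      rw [Finset.not_nonempty_iff_eq_empty] at h
      simp [tsum_conductance, tot, h]
    rw [stepDist, dif_pos h0, PMF.toMeasure_pure, lintegral_dirac, avg_of_isolated h]

instance (x : V) : IsProbabilityMeasure (T.walkLaw x) := by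
  unfold walkLaw; infer_instance

/-- The Markov property at time `n`. -/
theorem setLIntegral_walkLaw_succ (x : V) (n : ℕ) {S : Set (Finset.Iic n → V)}
    (hS : MeasurableSet S) (ψ : V → ℝ≥0∞) :
    ∫⁻ w in Preorder.frestrictLe n ⁻¹' S, ψ (w (n + 1)) ∂T.walkLaw x =
      ∫⁻ w in Preorder.frestrictLe n ⁻¹' S, (∫⁻ y, ψ y ∂T.stepKernel (w n)) ∂T.walkLaw x := by
  have hψ : Measurable ψ := measurable_of_countable _
  have hmS : MeasurableSet (Preorder.frestrictLe n ⁻¹' S : Set (ℕ → V)) :=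
    Preorder.measurable_frestrictLe n hS
  have hψ' : Measurable fun v => ∫⁻ y, ψ y ∂T.stepKernel v := measurable_of_countable _
  have hcp := Kernel.partialTraj_compProd_traj (X := fun _ => V) (κ := T.historyKernel)
    (Nat.zero_le n) (fun _ => x)
  have hmap := Kernel.traj_map_frestrictLe_apply (X := fun _ => V) (κ := T.historyKernel)
    0 n (fun _ => x)
  have hG : Measurable fun p : (Finset.Iic n → V) × (ℕ → V) =>
      S.indicator 1 p.1 * ψ (p.2 (n + 1)) :=
    ((measurable_one.indicator hS).comp measurable_fst).mul
      (hψ.comp ((measurable_pi_apply _).comp measurable_snd))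
  have hind : ∀ φ : (ℕ → V) → ℝ≥0∞, ∫⁻ w in Preorder.frestrictLe n ⁻¹' S, φ w ∂T.walkLaw x =
      ∫⁻ w, S.indicator 1 (Preorder.frestrictLe n w) * φ w ∂T.walkLaw x := by
    intro φ
    rw [← lintegral_indicator hmS]
    refine lintegral_congr fun w => ?_
    by_cases hw : Preorder.frestrictLe n w ∈ S
    · rw [Set.indicator_of_mem (by exact hw), Set.indicator_of_mem hw]; simp
    · rw [Set.indicator_of_notMem (by exact hw), Set.indicator_of_notMem hw]; simp
  calc ∫⁻ w in Preorder.frestrictLe n ⁻¹' S, ψ (w (n + 1)) ∂T.walkLaw x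
      = ∫⁻ w, S.indicator 1 (Preorder.frestrictLe n w) * ψ (w (n + 1)) ∂T.walkLaw x :=
        hind _
    _ = ∫⁻ a, ∫⁻ w, S.indicator 1 a * ψ (w (n + 1)) ∂Kernel.traj (X := fun _ => V)
          T.historyKernel n a ∂Kernel.partialTraj (X := fun _ => V) T.historyKernel 0 n
          (fun _ => x) := by
        rw [← Measure.lintegral_compProd hG, hcp, lintegral_map hG (by fun_prop)]
        rfl
    _ = ∫⁻ a, S.indicator 1 a * ∫⁻ y, ψ y ∂T.stepKernel (a ⟨n, Finset.mem_Iic.2 le_rfl⟩)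
          ∂Kernel.partialTraj (X := fun _ => V) T.historyKernel 0 n (fun _ => x) := by
        refine lintegral_congr fun a => ?_
        rw [lintegral_const_mul (f := fun w : ℕ → V => ψ (w (n + 1))) _
          (hψ.comp (measurable_pi_apply (n + 1)))]
        congr 1
        have h1 : (Kernel.traj (X := fun _ => V) T.historyKernel n a).map (fun w => w (n + 1)) =
            T.historyKernel n a := by
          rw [← Kernel.map_apply _ (measurable_pi_apply _), Kernel.map_traj_succ_self]
        rw [← lintegral_map (f := ψ) hψ (measurable_pi_apply (n + 1)), h1]
        rfl
    _ = ∫⁻ w, S.indicator 1 (Preorder.frestrictLe n w) * ∫⁻ y, ψ y ∂T.stepKernel (w n)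
          ∂T.walkLaw x := by
        rw [← hmap, lintegral_map _ (Preorder.measurable_frestrictLe n)]
        · rfl
        · exact (measurable_one.indicator hS).mul (hψ'.comp (measurable_pi_apply _))
    _ = _ := (hind _).symm

/-- The event that the trajectory does not visit `x` at the times `1, …, n`. -/
def noReturn (x : V) (n : ℕ) : Set (ℕ → V) := {w | ∀ k, 1 ≤ k → k ≤ n → w k ≠ x}

theorem measurableSet_noReturn (x : V) (n : ℕ) : MeasurableSet (noReturn x n) := by
  have : noReturn x n = ⋂ k, ⋂ (_ : 1 ≤ k), ⋂ (_ : k ≤ n), (fun w : ℕ → V => w k) ⁻¹' {x}ᶜ := by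
    ext w; simp [noReturn]
  rw [this]
  exact .iInter fun k => .iInter fun _ => .iInter fun _ =>
    measurable_pi_apply k (Set.to_countable _).measurableSet

/-- The law of the walk at time `n` on the event that it has not returned is given by the `n`-th
power of the killed transition operator. The induction peels off the last step. -/
theorem setLIntegral_noReturn (x : V) (n : ℕ) {u : V → ℝ} (hu : ∀ v, 0 ≤ u v) :
    ∫⁻ w in noReturn x n, ENNReal.ofReal (u (w n)) ∂T.walkLaw x =
      ENNReal.ofReal ((killedAvg T x)^[n] u x) := by
  induction n generalizing u with
  | zero =>
    have h1 : noReturn x 0 = Set.univ := by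
      ext w; simp only [noReturn, Set.mem_ofPred_eq, Set.mem_univ, iff_true]; omega
    have hmap := Kernel.traj_map_frestrictLe_apply (X := fun _ => V) (κ := T.historyKernel)
      0 0 (fun _ => x)
    rw [Kernel.partialTraj_self, Kernel.id_apply] at hmap
    have hf : Measurable fun a : Finset.Iic 0 → V =>
        ENNReal.ofReal (u (a ⟨0, Finset.mem_Iic.2 le_rfl⟩)) :=
      (measurable_of_countable fun v => ENNReal.ofReal (u v)).comp (measurable_pi_apply _)
    rw [h1, Measure.restrict_univ]
    calc _ = ∫⁻ a, ENNReal.ofReal (u (a ⟨0, Finset.mem_Iic.2 le_rfl⟩))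
          ∂((T.walkLaw x).map (Preorder.frestrictLe 0)) := by
          rw [lintegral_map hf (Preorder.measurable_frestrictLe 0)]; rfl
      _ = _ := by
          rw [walkLaw, hmap, lintegral_dirac' _ hf]; rfl
  | succ n ih =>
    classical
    have hS : MeasurableSet {a : Finset.Iic n → V |
        ∀ k (h1 : 1 ≤ k) (h : k ≤ n), a ⟨k, Finset.mem_Iic.2 h⟩ ≠ x} := by
      have : {a : Finset.Iic n → V | ∀ k (h1 : 1 ≤ k) (h : k ≤ n), a ⟨k, Finset.mem_Iic.2 h⟩ ≠ x} =
          ⋂ k, ⋂ (_ : 1 ≤ k), ⋂ (h : k ≤ n),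
            (fun a : Finset.Iic n → V => a ⟨k, Finset.mem_Iic.2 h⟩) ⁻¹' {x}ᶜ := by
        ext w; simp
      rw [this]
      exact .iInter fun k => .iInter fun _ => .iInter fun _ =>
        measurable_pi_apply _ (Set.to_countable _).measurableSet
    have hpre : Preorder.frestrictLe n ⁻¹' {a : Finset.Iic n → V |
        ∀ k (h1 : 1 ≤ k) (h : k ≤ n), a ⟨k, Finset.mem_Iic.2 h⟩ ≠ x} = noReturn x n := rfl
    have hu' : ∀ v, 0 ≤ if v = x then 0 else u v := fun v => by
      split_ifs <;> [exact le_rfl; exact hu v]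
    rw [Function.iterate_succ_apply, ← ih (killedAvg_nonneg hu)]
    have key := setLIntegral_walkLaw_succ (T := T) x n hS
      (fun v => ENNReal.ofReal (if v = x then 0 else u v))
    rw [hpre] at key
    calc _ = ∫⁻ w in noReturn x n, ENNReal.ofReal (if w (n + 1) = x then 0 else u (w (n + 1)))
          ∂T.walkLaw x := by
          rw [← lintegral_indicator (measurableSet_noReturn x _),
            ← lintegral_indicator (measurableSet_noReturn x _)]
          refine lintegral_congr fun w => ?_
          by_cases hw : w ∈ noReturn x n
          · rw [Set.indicator_of_mem hw]
            by_cases hx : w (n + 1) = x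
            · rw [if_pos hx, Set.indicator_of_notMem]
              · simp
              · exact fun h => h (n + 1) (by omega) le_rfl hx
            · rw [if_neg hx, Set.indicator_of_mem]
              intro k hk hkn
              rcases Nat.lt_or_eq_of_le hkn with h | rfl
              · exact hw k hk (by omega)
              · exact hx
          · rw [Set.indicator_of_notMem hw, Set.indicator_of_notMem]
            exact fun h => hw fun k hk hkn => h k hk (by omega)
      _ = _ := by
          rw [key]
          refine lintegral_congr fun w => ?_
          exact lintegral_stepDist hu' (w n)

theorem walkLaw_noReturn_succ (x : V) (n : ℕ) :
    T.walkLaw x (noReturn x (n + 1)) = ENNReal.ofReal (T.avg (T.avoid x n) x) := by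
  have := setLIntegral_noReturn (T := T) x (n + 1) (u := fun _ => 1) fun _ => zero_le_one
  rw [iterate_killedAvg_one] at this
  simpa using this

theorem walkLaw_compl_return (x : V) :
    T.walkLaw x {w | ∃ n, 1 ≤ n ∧ w n = x}ᶜ = ENNReal.ofReal (T.avg (T.avoidAlways x) x) := by
  have hset : {w : ℕ → V | ∃ n, 1 ≤ n ∧ w n = x}ᶜ = ⋂ n, noReturn x (n + 1) := by
    ext w
    simp only [Set.mem_compl_iff, Set.mem_ofPred_eq, not_exists, not_and, Set.mem_iInter, noReturn]
    exact ⟨fun h n k hk _ => h k hk, fun h k hk => h k k hk (by omega)⟩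
  rw [hset]
  have h1 : Tendsto (fun n => T.walkLaw x (noReturn x (n + 1))) atTop
      (𝓝 (T.walkLaw x (⋂ n, noReturn x (n + 1)))) := by
    refine tendsto_measure_iInter_atTop
      (fun n => (measurableSet_noReturn x _).nullMeasurableSet) ?_ ⟨0, measure_ne_top _ _⟩
    exact fun m n hmn w hw k hk hkn => hw k hk (by omega)
  simp_rw [walkLaw_noReturn_succ] at h1
  exact tendsto_nhds_unique h1 (ENNReal.tendsto_ofReal (tendsto_avg (tendsto_avoid x) x))

theorem measurableSet_return (x : V) : MeasurableSet {w : ℕ → V | ∃ n, 1 ≤ n ∧ w n = x} := by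
  have : {w : ℕ → V | ∃ n, 1 ≤ n ∧ w n = x} =
      ⋃ n, ⋃ (_ : 1 ≤ n), (fun w : ℕ → V => w n) ⁻¹' {x} := by
    ext w; simp
  rw [this]
  exact .iUnion fun k => .iUnion fun _ => measurable_pi_apply k (measurableSet_singleton x)

theorem isRecurrent_iff : T.IsRecurrent ↔ ∀ x, T.avg (T.avoidAlways x) x ≤ 0 := by
  refine forall_congr' fun x => ?_
  rw [← prob_compl_eq_zero_iff (measurableSet_return x), walkLaw_compl_return,
    ENNReal.ofReal_eq_zero]

theorem isTransient_iff : T.IsTransient ↔ ∀ x, 0 < T.avg (T.avoidAlways x) x := by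
  refine forall_congr' fun x => ?_
  rw [lt_iff_le_and_ne, ne_eq, ← prob_compl_eq_zero_iff (measurableSet_return x),
    walkLaw_compl_return, ENNReal.ofReal_eq_zero, not_le]
  exact and_iff_right prob_le_one

end

end WeightedTree

namespace WeightedTree

open Filter Topology

/-! ### The rooted tree -/

variable {V : Type*} (T : WeightedTree V) (ρ : V)

/-- The generation of a vertex in the tree rooted at `ρ`. -/
noncomputable def level (v : V) : ℕ := (weightGraph T.r).dist ρ v

open Classical in
/-- The children of a vertex in the tree rooted at `ρ`. -/
noncomputable def children (v : V) : Finset V :=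
  (T.nbr v).filter fun c => T.level ρ c = T.level ρ v + 1

open Classical in
/-- The parent of a vertex in the tree rooted at `ρ`; the root is its own parent. -/
noncomputable def parent (v : V) : V :=
  if h : ∃ p, v ∈ T.children ρ p then h.choose else v

/-- The sum of `g` over the vertices other than `ρ` on the path from `ρ` to `v`. -/
noncomputable def pathSum (g : V → ℝ) (v : V) : ℝ :=
  ∑ k ∈ Finset.range (T.level ρ v), g ((T.parent ρ)^[k] v)

/-- The length of the edge from a vertex to its parent (`0` at the root). -/
noncomputable def len (v : V) : ℝ := T.r s(T.parent ρ v, v)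

/-- The tree distance from `ρ` for the edge lengths `r`. -/
noncomputable def rootDist (v : V) : ℝ := T.pathSum ρ (T.len ρ) v

variable {T ρ}

theorem mem_children {v c : V} :
    c ∈ T.children ρ v ↔ (weightGraph T.r).Adj v c ∧ T.level ρ c = T.level ρ v + 1 := by
  simp [children, mem_nbr]

theorem level_of_mem {v c : V} (h : c ∈ T.children ρ v) : T.level ρ c = T.level ρ v + 1 :=
  (mem_children.1 h).2

theorem level_root : T.level ρ ρ = 0 := by simp [level]

theorem ne_root_of_mem {v c : V} (h : c ∈ T.children ρ v) : c ≠ ρ := by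
  rintro rfl
  have := level_of_mem h
  rw [level_root] at this
  omega

theorem level_eq_zero {v : V} : T.level ρ v = 0 ↔ v = ρ := by
  rw [level, (T.isTree.connected).dist_eq_zero_iff, eq_comm]

theorem eq_of_mem_children {p q v : V} (hp : v ∈ T.children ρ p) (hq : v ∈ T.children ρ q) :
    p = q := by
  rw [mem_children] at hp hq
  have key : ∀ p, (hadj : (weightGraph T.r).Adj p v) → T.level ρ v = T.level ρ p + 1 →
      ∃ w : (weightGraph T.r).Walk ρ v, w.IsPath ∧ w.penultimate = p := by
    intro p hadj hl
    obtain ⟨w, hw⟩ := T.isTree.connected.exists_walk_length_eq_dist ρ p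
    refine ⟨w.concat hadj, SimpleGraph.Walk.isPath_of_length_eq_dist _ ?_, by simp⟩
    rw [SimpleGraph.Walk.length_concat, hw]; exact hl.symm
  obtain ⟨w, hw, rfl⟩ := key p hp.1 hp.2
  obtain ⟨w', hw', rfl⟩ := key q hq.1 hq.2
  rw [(T.isTree.existsUnique_path _ _).unique hw hw']

theorem parent_of_mem {v c : V} (h : c ∈ T.children ρ v) : T.parent ρ c = v := by
  have hex : ∃ p, c ∈ T.children ρ p := ⟨v, h⟩
  rw [parent, dif_pos hex]
  exact eq_of_mem_children hex.choose_spec h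

theorem mem_children_parent {v : V} (h : v ≠ ρ) : v ∈ T.children ρ (T.parent ρ v) := by
  suffices hex : ∃ p, v ∈ T.children ρ p by
    rw [parent, dif_pos hex]; exact hex.choose_spec
  obtain ⟨w, hw⟩ := T.isTree.connected.exists_walk_length_eq_dist ρ v
  have hnil : ¬ w.Nil := SimpleGraph.Walk.not_nil_of_ne (Ne.symm h)
  refine ⟨w.penultimate, mem_children.2 ⟨w.adj_penultimate hnil, ?_⟩⟩
  rcases T.isTree.dist_eq_dist_add_one_of_adj ρ (w.adj_penultimate hnil) with h1 | h1
  · exfalso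
    have h2 := SimpleGraph.dist_le w.dropLast
    have h3 : w.dropLast.length + 1 = w.length :=
      SimpleGraph.Walk.length_dropLast_add_one hnil
    omega
  · exact h1

theorem sum_nbr (f : V → ℝ) {v : V} (h : v ≠ ρ) :
    ∑ y ∈ T.nbr v, f y = f (T.parent ρ v) + ∑ c ∈ T.children ρ v, f c := by
  classical
  have hp := mem_children_parent (T := T) h
  have hp' := mem_children.1 hp
  have hnot : T.parent ρ v ∉ T.children ρ v := by
    intro hc; have := level_of_mem hc; omega
  rw [← Finset.sum_insert hnot]
  refine Finset.sum_congr ?_ fun _ _ => rfl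
  ext y
  rw [Finset.mem_insert, mem_nbr]
  constructor
  · intro hy
    rcases T.isTree.dist_eq_dist_add_one_of_adj ρ hy with h1 | h1
    · exact Or.inl (eq_of_mem_children (mem_children.2 ⟨hy.symm, h1⟩) hp)
    · exact Or.inr (mem_children.2 ⟨hy, h1⟩)
  · rintro (rfl | hy)
    · exact hp'.1.symm
    · exact (mem_children.1 hy).1

theorem children_root : T.children ρ ρ = T.nbr ρ := by
  ext y
  rw [mem_children, mem_nbr, and_iff_left_iff_imp]
  intro hy
  rw [level_root]
  exact SimpleGraph.dist_eq_one_iff_adj.2 hy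

/-- Induction from the root along the edges of the tree. -/
theorem root_induction {P : V → Prop} (h0 : P ρ)
    (hs : ∀ v, ∀ c ∈ T.children ρ v, P v → P c) (v : V) : P v := by
  obtain ⟨n, hn⟩ : ∃ n, T.level ρ v = n := ⟨_, rfl⟩
  induction n generalizing v with
  | zero => rw [level_eq_zero.1 hn]; exact h0
  | succ n ih =>
    have hne : v ≠ ρ := fun h => by rw [level_eq_zero.2 h] at hn; omega
    have hm := mem_children_parent (T := T) hne
    exact hs _ v hm (ih _ (by have := level_of_mem hm; omega))

theorem pathSum_root (g : V → ℝ) : T.pathSum ρ g ρ = 0 := by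
  simp [pathSum, level_root]

theorem pathSum_child (g : V → ℝ) {v c : V} (h : c ∈ T.children ρ v) :
    T.pathSum ρ g c = T.pathSum ρ g v + g c := by
  rw [pathSum, level_of_mem h, Finset.sum_range_succ']
  simp only [Function.iterate_succ_apply, parent_of_mem h, Function.iterate_zero, id]
  rfl

theorem len_of_mem {v c : V} (h : c ∈ T.children ρ v) : T.len ρ c = T.r s(v, c) := by
  rw [len, parent_of_mem h]

theorem len_pos {v c : V} (h : c ∈ T.children ρ v) : 0 < T.len ρ c := by
  rw [len_of_mem h]; exact (mem_children.1 h).1.2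

theorem rootDist_root : T.rootDist ρ ρ = 0 := pathSum_root _

theorem rootDist_child {v c : V} (h : c ∈ T.children ρ v) :
    T.rootDist ρ c = T.rootDist ρ v + T.len ρ c := pathSum_child _ h

theorem rootDist_nonneg (v : V) : 0 ≤ T.rootDist ρ v := by
  unfold rootDist pathSum len
  exact Finset.sum_nonneg fun _ _ => NNReal.zero_le_coe

/-- If `θ` is the gradient of `u` along the edges leading away from the root, then the Laplacian of
`u` is the net flow of `θ` out of the vertex. -/
theorem lap_eq {u θ : V → ℝ}
    (hθ : ∀ v, ∀ c ∈ T.children ρ v, u c = u v + T.len ρ c * θ c) {v : V} (hv : v ≠ ρ) :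
    T.lap u v = ∑ c ∈ T.children ρ v, θ c - θ v := by
  have hm := mem_children_parent (T := T) hv
  rw [lap, sum_nbr _ hv, add_comm, sub_eq_add_neg]
  congr 1
  · refine Finset.sum_congr rfl fun c hc => ?_
    have h0 := (len_pos hc).ne'
    rw [hθ v c hc, cond, ← len_of_mem hc]
    field_simp
    ring
  · have h0 := (len_pos hm).ne'
    rw [hθ _ v hm, cond, Sym2.eq_swap, ← len_of_mem hm]
    field_simp
    ring

theorem lap_root_eq {u θ : V → ℝ}
    (hθ : ∀ v, ∀ c ∈ T.children ρ v, u c = u v + T.len ρ c * θ c) :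
    T.lap u ρ = ∑ c ∈ T.children ρ ρ, θ c := by
  rw [lap, ← children_root]
  refine Finset.sum_congr rfl fun c hc => ?_
  have h0 := (len_pos hc).ne'
  rw [hθ ρ c hc, cond, ← len_of_mem hc]
  field_simp
  ring

/-- The probability of avoiding the root increases along the edges leading away from it. -/
theorem avoid_parent_le (n : ℕ) {v c : V} (h : c ∈ T.children ρ v) :
    T.avoid ρ n v ≤ T.avoid ρ n c := by
  induction n generalizing v c with
  | zero =>
    have : T.avoid ρ 0 c = 1 := if_neg (ne_root_of_mem h)
    rw [this]; exact avoid_le_one _ _ _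
  | succ n ih =>
    refine (avoid_succ_le ρ n v).trans ?_
    rw [avoid_succ (ne_root_of_mem h)]
    have hnb : (T.nbr c).Nonempty := ⟨v, mem_nbr.2 (mem_children.1 h).1.symm⟩
    have htot := tot_pos_iff.2 hnb
    have hge : ∀ y ∈ T.nbr c, T.avoid ρ n v ≤ T.avoid ρ n y := by
      intro y hy
      rcases T.isTree.dist_eq_dist_add_one_of_adj ρ (mem_nbr.1 hy) with h1 | h1
      · rw [eq_of_mem_children (mem_children.2 ⟨(mem_nbr.1 hy).symm, h1⟩) h]
      · exact (ih h).trans (ih (mem_children.2 ⟨mem_nbr.1 hy, h1⟩))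
    calc T.avoid ρ n v = T.avg (fun _ => T.avoid ρ n v) c := (avg_const _ _).symm
      _ ≤ T.avg (T.avoid ρ n) c := by
        rw [avg_eq hnb, avg_eq hnb]
        exact Finset.sum_le_sum fun y hy =>
          mul_le_mul_of_nonneg_left (hge y hy) (div_nonneg (cond_nonneg _ _) htot.le)

theorem avoidAlways_parent_le {v c : V} (h : c ∈ T.children ρ v) :
    T.avoidAlways ρ v ≤ T.avoidAlways ρ c :=
  le_of_tendsto_of_tendsto' (tendsto_avoid ρ v) (tendsto_avoid ρ c) fun n => avoid_parent_le n h

/-! ### Directions and cylinders -/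

namespace Direction

theorem adj (x : T.Direction ρ) (n : ℕ) :
    (weightGraph T.r).Adj (x.vertex n) (x.vertex (n + 1)) :=
  ⟨fun h => by simpa using x.injective h, x.edge n⟩

theorem level_vertex (x : T.Direction ρ) (n : ℕ) : T.level ρ (x.vertex n) = n := by
  obtain ⟨p, hp⟩ := x.exists_path n
  obtain ⟨q, hq, hl⟩ := (T.isTree.connected ρ (x.vertex n)).exists_path_of_dist
  have hp' : p.IsPath := by
    rw [SimpleGraph.Walk.isPath_def, hp]
    exact List.Nodup.map x.injective List.nodup_range
  have hlen := congrArg List.length hp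
  rw [SimpleGraph.Walk.length_support, List.length_map, List.length_range] at hlen
  rw [level, ← hl, (T.isTree.existsUnique_path _ _).unique hq hp']
  omega

theorem mem_children (x : T.Direction ρ) (n : ℕ) :
    x.vertex (n + 1) ∈ T.children ρ (x.vertex n) :=
  WeightedTree.mem_children.2 ⟨x.adj n, by rw [level_vertex, level_vertex]⟩

theorem height_eq_rootDist (x : T.Direction ρ) (n : ℕ) :
    x.height n = ENNReal.ofReal (T.rootDist ρ (x.vertex n)) := by
  induction n with
  | zero => simp [height, x.zero, rootDist_root]
  | succ n ih =>
    rw [height, Finset.sum_range_succ, rootDist_child (x.mem_children n),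
      ENNReal.ofReal_add (rootDist_nonneg _) (len_pos (x.mem_children n)).le, ← ih,
      len_of_mem (x.mem_children n), ENNReal.ofReal_coe_nnreal]
    rfl

theorem height_ne_top (x : T.Direction ρ) (n : ℕ) : x.height n ≠ ∞ :=
  ENNReal.sum_ne_top.2 fun _ _ => ENNReal.coe_ne_top

theorem tendsto_height {x : T.Direction ρ} (hx : x.totalResistance = ∞) :
    Tendsto x.height atTop (𝓝 ∞) := by
  rw [← hx]
  exact ENNReal.summable.hasSum.tendsto_sum_nat

/-- The direction that runs through a given sequence of successive children. -/
def ofChildren (x : ℕ → V) (h0 : x 0 = ρ) (hx : ∀ n, x (n + 1) ∈ T.children ρ (x n)) :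
    T.Direction ρ where
  vertex := x
  zero := h0
  injective := by
    have hl : ∀ n, T.level ρ (x n) = n := by
      intro n
      induction n with
      | zero => rw [h0, level_root]
      | succ n ih => rw [level_of_mem (hx n), ih]
    intro m n hmn
    rw [← hl m, ← hl n, hmn]
  edge n := (WeightedTree.mem_children.1 (hx n)).1.2

theorem vertex_eq_of_edist_lt {x y : T.Direction ρ} {n : ℕ} (h : edist x y < (x.height n)⁻¹)
    (h1 : edist x y < 1) : x.vertex n = y.vertex n := by
  by_cases hxy : x = y
  · rw [hxy]
  · rw [edist_of_ne hxy] at h h1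
    have h2 : (x.height (meetIndex x y))⁻¹ < (x.height n)⁻¹ := by
      rcases min_lt_iff.1 h with h | h
      · exact h
      · exact (min_lt_iff.1 h1).elim (fun h3 => h3.trans h) (fun h3 => absurd h3 (lt_irrefl _))
    have h3 : n ≤ meetIndex x y := by
      by_contra! hlt
      exact absurd (x.height_mono hlt.le) (not_le.2 (ENNReal.inv_lt_inv.1 h2))
    exact agree_of_le (vertex_meetIndex hxy) h3

/-- A set of directions is open if membership depends only on an initial segment. -/
theorem isOpen_of_vertex {s : Set (T.Direction ρ)} (n : ℕ)
    (hs : ∀ x ∈ s, ∀ y, x.vertex n = y.vertex n → y ∈ s) : IsOpen s := by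
  rw [EMetric.isOpen_iff]
  intro x hx
  refine ⟨min (x.height n)⁻¹ 1, ?_, fun y hy => hs x hx y ?_⟩
  · exact lt_min (ENNReal.inv_pos.2 (x.height_ne_top n)) zero_lt_one
  · rw [Metric.mem_eball, edist_comm, lt_min_iff] at hy
    exact vertex_eq_of_edist_lt hy.1 hy.2

end Direction

variable (T ρ)

/-- The set of directions that run through the vertex `v`. -/
def cyl (v : V) : Set (T.Direction ρ) := {x | x.vertex (T.level ρ v) = v}

variable {T ρ}

theorem mem_cyl {v : V} {x : T.Direction ρ} : x ∈ T.cyl ρ v ↔ x.vertex (T.level ρ v) = v := Iff.rfl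

theorem mem_cyl_vertex (x : T.Direction ρ) (n : ℕ) : x ∈ T.cyl ρ (x.vertex n) := by
  rw [mem_cyl, x.level_vertex]

theorem cyl_root : T.cyl ρ ρ = Set.univ := by
  ext x; simp [mem_cyl, level_root, x.zero]

theorem cyl_subset (v : V) : T.cyl ρ v ⊆ ⋃ c ∈ T.children ρ v, T.cyl ρ c := by
  intro x hx
  have := x.mem_children (T.level ρ v)
  rw [mem_cyl.1 hx] at this
  exact Set.mem_biUnion this (mem_cyl_vertex _ _)

theorem ediam_cyl_le (v : V) :
    Metric.ediam (T.cyl ρ v) ≤ min (ENNReal.ofReal (T.rootDist ρ v))⁻¹ 1 := by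
  refine Metric.ediam_le fun x hx y hy => ?_
  by_cases hxy : x = y
  · rw [hxy, Direction.edist_self']; exact zero_le
  · rw [Direction.edist_of_ne hxy]
    refine min_le_min_right _ (ENNReal.inv_le_inv.2 ?_)
    have h := x.height_eq_rootDist (T.level ρ v)
    rw [mem_cyl.1 hx] at h
    rw [← h]
    exact x.height_mono (Direction.le_meetIndex hxy (hx.trans hy.symm))

end WeightedTree

namespace WeightedTree

open Filter Topology

variable {V : Type*} {T : WeightedTree V} {ρ : V}

/-! ### Flows and coverings of the space of directions -/

variable (T ρ) in
/-- The vertices `v` such that `w` lies on the path from `ρ` to `v`. -/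
def subtree (w : V) : Set V :=
  {v | T.level ρ w ≤ T.level ρ v ∧ (T.parent ρ)^[T.level ρ v - T.level ρ w] v = w}

theorem mem_subtree_self (w : V) : w ∈ T.subtree ρ w := ⟨le_rfl, by simp⟩

theorem subtree_child {w c : V} (h : c ∈ T.children ρ w) : T.subtree ρ c ⊆ T.subtree ρ w := by
  rintro v ⟨hl, hv⟩
  have hc := level_of_mem h
  refine ⟨by omega, ?_⟩
  rw [show T.level ρ v - T.level ρ w = (T.level ρ v - T.level ρ c) + 1 by omega,
    Function.iterate_succ_apply', hv, parent_of_mem h]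

theorem eq_of_mem_subtree {w c c' v : V} (h : c ∈ T.children ρ w) (h' : c' ∈ T.children ρ w)
    (hv : v ∈ T.subtree ρ c) (hv' : v ∈ T.subtree ρ c') : c = c' := by
  rw [← hv.2, ← hv'.2, level_of_mem h, level_of_mem h']

open Classical in
/-- If every direction runs through one of the vertices `v i`, then these vertices carry at least
the strength of the flow `θ`: otherwise there would be a direction along which, at every vertex, the
flow exceeds what the `v i` beyond that vertex carry, and this direction could not run through any
of them. -/
theorem flow_root_le_tsum {θ : V → ℝ≥0∞} (hθ : ∀ v, θ v ≤ ∑ c ∈ T.children ρ v, θ c)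
    {ι : Type*} (v : ι → V) (hv : ∀ x : T.Direction ρ, ∃ i, x ∈ T.cyl ρ (v i)) :
    θ ρ ≤ ∑' i, θ (v i) := by
  by_contra! hlt
  let S : V → ℝ≥0∞ := fun w => ∑' i, if v i ∈ T.subtree ρ w then θ (v i) else 0
  have hstep : ∀ w, S w < θ w → ∃ c ∈ T.children ρ w, S c < θ c := by
    intro w hw
    by_contra! hc
    refine absurd hw (not_lt.2 ?_)
    calc θ w ≤ ∑ c ∈ T.children ρ w, θ c := hθ w
      _ ≤ ∑ c ∈ T.children ρ w, S c := Finset.sum_le_sum hc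
      _ = ∑' i, ∑ c ∈ T.children ρ w, if v i ∈ T.subtree ρ c then θ (v i) else 0 :=
        (Summable.tsum_finsetSum fun _ _ => ENNReal.summable).symm
      _ ≤ S w := by
        refine ENNReal.tsum_le_tsum fun i => ?_
        by_cases hex : ∃ c ∈ T.children ρ w, v i ∈ T.subtree ρ c
        · obtain ⟨c, hc, hi⟩ := hex
          rw [Finset.sum_eq_single c, if_pos hi, if_pos (subtree_child hc hi)]
          · intro c' hc' hne
            exact if_neg fun hi' => hne (eq_of_mem_subtree hc' hc hi' hi)
          · exact fun h => absurd hc h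
        · push Not at hex
          rw [Finset.sum_eq_zero fun c hc => if_neg (hex c hc)]
          exact zero_le
  have hroot : S ρ < θ ρ := by
    refine lt_of_le_of_lt (ENNReal.tsum_le_tsum fun i => ?_) hlt
    split_ifs <;> simp
  choose! next hnext hnext' using hstep
  let x : ℕ → V := fun n => next^[n] ρ
  have hbad : ∀ n, S (x n) < θ (x n) := by
    intro n
    induction n with
    | zero => exact hroot
    | succ n ih =>
      simp only [x, Function.iterate_succ_apply']
      exact hnext' _ ih
  obtain ⟨i, hi⟩ := hv (Direction.ofChildren x rfl fun n => by
    simp only [x, Function.iterate_succ_apply']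
    exact hnext _ (hbad n))
  have hi' : x (T.level ρ (v i)) = v i := hi
  have h1 := hbad (T.level ρ (v i))
  rw [hi'] at h1
  refine absurd h1 (not_lt.2 ?_)
  have h2 := ENNReal.le_tsum (f := fun j => if v j ∈ T.subtree ρ (v i) then θ (v j) else 0) i
  rwa [if_pos (mem_subtree_self _)] at h2

/-- The largest outer measure on the space of directions that gives the set of directions through
`v` at most the mass `θ v`, for every vertex `v`. No additivity is built in. -/
noncomputable def flowMeasure (T : WeightedTree V) (ρ : V) (θ : V → ℝ≥0∞) :
    OuterMeasure (T.Direction ρ) :=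
  OuterMeasure.boundedBy fun s => ⨅ (v : V) (_ : s ⊆ T.cyl ρ v), θ v

theorem flowMeasure_le {θ : V → ℝ≥0∞} {s : Set (T.Direction ρ)} {v : V} (h : s ⊆ T.cyl ρ v) :
    flowMeasure T ρ θ s ≤ θ v :=
  (OuterMeasure.boundedBy_le s).trans (iInf₂_le v h)

theorem flow_root_le_flowMeasure {θ : V → ℝ≥0∞}
    (hθ : ∀ v, θ v ≤ ∑ c ∈ T.children ρ v, θ c) : θ ρ ≤ flowMeasure T ρ θ Set.univ := by
  rw [flowMeasure, OuterMeasure.boundedBy_apply]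
  refine le_iInf₂ fun t ht => ENNReal.le_of_forall_pos_le_add fun ε hε _ => ?_
  obtain ⟨e, he, hes⟩ := ENNReal.exists_pos_sum_of_countable (ENNReal.coe_pos.2 hε).ne' ℕ
  have hex : ∀ n, ∃ v, t n ⊆ T.cyl ρ v ∧
      θ v ≤ (⨅ (v : V) (_ : t n ⊆ T.cyl ρ v), θ v) + e n := by
    intro n
    by_cases htop : (⨅ (v : V) (_ : t n ⊆ T.cyl ρ v), θ v) = ∞
    · exact ⟨ρ, by rw [cyl_root]; exact Set.subset_univ _, by rw [htop]; simp⟩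
    · have := ENNReal.lt_add_right htop (ENNReal.coe_pos.2 (he n)).ne'
      obtain ⟨v, hv⟩ := iInf_lt_iff.1 this
      obtain ⟨hv1, hv2⟩ := iInf_lt_iff.1 hv
      exact ⟨v, hv1, hv2.le⟩
  choose v hv1 hv2 using hex
  calc θ ρ ≤ ∑' i : {n // (t n).Nonempty}, θ (v i) := by
        refine flow_root_le_tsum hθ _ fun x => ?_
        obtain ⟨n, hn⟩ := Set.mem_iUnion.1 (ht (Set.mem_univ x))
        exact ⟨⟨n, ⟨x, hn⟩⟩, hv1 n hn⟩
    _ ≤ ∑' i : {n // (t n).Nonempty}, ((⨆ _ : (t i).Nonempty,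
          ⨅ (v : V) (_ : t i ⊆ T.cyl ρ v), θ v) + e i) := by
        refine ENNReal.tsum_le_tsum fun i => (hv2 i).trans (add_le_add_left ?_ _)
        exact le_iSup (fun _ : (t i).Nonempty => ⨅ (v : V) (_ : t i ⊆ T.cyl ρ v), θ v) i.2
    _ ≤ ∑' n, ((⨆ _ : (t n).Nonempty, ⨅ (v : V) (_ : t n ⊆ T.cyl ρ v), θ v) + e n) :=
        ENNReal.tsum_comp_le_tsum_of_injective Subtype.val_injective
          (fun n => (⨆ _ : (t n).Nonempty, ⨅ (v : V) (_ : t n ⊆ T.cyl ρ v), θ v) + e n)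
    _ ≤ _ := by
        rw [ENNReal.tsum_add]
        exact add_le_add_right hes.le _

/-- If `θ ≤ δ / h` at all vertices of height `h ≥ N` on the directions in `D`, then the part in `D`
of a set of small diameter has mass at most `δ` times this diameter. For `r` slightly larger than the
diameter, the set lies beyond the first vertex of height at least `r⁻¹` on any of its directions. The
detour through `r` covers sets with a single point, whose diameter is `0`. -/
theorem flowMeasure_inter_le {θ : V → ℝ≥0∞} {δ : ℝ≥0∞} (hδ : δ ≠ ∞) {N : ℕ}
    {D : Set (T.Direction ρ)} (htot : ∀ x : T.Direction ρ, x.totalResistance = ∞)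
    (hD : ∀ x ∈ D, ∀ n, (N : ℝ≥0∞) ≤ x.height n → θ (x.vertex n) * x.height n ≤ δ)
    {s : Set (T.Direction ρ)} (hs : Metric.ediam s ≤ (N + 2 : ℝ≥0∞)⁻¹) :
    flowMeasure T ρ θ (s ∩ D) ≤ δ * Metric.ediam s := by
  rcases (s ∩ D).eq_empty_or_nonempty with he | ⟨x, hxs, hxD⟩
  · rw [he, measure_empty]; exact zero_le
  have hlt : Metric.ediam s < (N + 1 : ℝ≥0∞)⁻¹ := by
    refine hs.trans_lt (ENNReal.inv_lt_inv.2 ?_)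
    exact_mod_cast Nat.lt_succ_self (N + 1)
  have hev : ∀ r ∈ Set.Ioo (Metric.ediam s) (N + 1 : ℝ≥0∞)⁻¹,
      flowMeasure T ρ θ (s ∩ D) ≤ δ * r := by
    rintro r ⟨hr1, hr2⟩
    have hr0 : r ≠ 0 := (zero_le.trans_lt hr1).ne'
    have hrt : r ≠ ∞ := hr2.ne_top
    have hrone : r < 1 := hr2.trans_le (ENNReal.inv_le_one.2 (by simp))
    have hrN : (N : ℝ≥0∞) ≤ r⁻¹ := by
      rw [ENNReal.le_inv_iff_le_inv]
      exact hr2.le.trans (ENNReal.inv_le_inv.2 (by simp))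
    classical
    have hex : ∃ n, r⁻¹ ≤ x.height n :=
      ((Direction.tendsto_height (htot x)).eventually
        (lt_mem_nhds (ENNReal.inv_lt_top.2 (pos_iff_ne_zero.2 hr0)))).exists.imp fun _ h => h.le
    have hsub : s ∩ D ⊆ T.cyl ρ (x.vertex (Nat.find hex)) := by
      rintro y ⟨hy, -⟩
      rw [mem_cyl, x.level_vertex]
      by_cases hxy : x = y
      · rw [← hxy]
      have h1 : edist x y < r := (Metric.edist_le_ediam_of_mem hxs hy).trans_lt hr1
      rw [Direction.edist_of_ne hxy] at h1
      have h2 : (x.height (Direction.meetIndex x y))⁻¹ < r :=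
        (min_lt_iff.1 h1).resolve_right hrone.not_gt
      have h3 : Nat.find hex ≤ Direction.meetIndex x y :=
        Nat.find_min' hex (ENNReal.inv_le_iff_inv_le.1 h2.le)
      exact (Direction.agree_of_le (Direction.vertex_meetIndex hxy) h3).symm
    refine (flowMeasure_le hsub).trans ?_
    have h4 := hD x hxD _ (hrN.trans (Nat.find_spec hex))
    have h5 : θ (x.vertex (Nat.find hex)) * r⁻¹ ≤ δ :=
      (mul_le_mul_right (Nat.find_spec hex) _).trans h4
    rwa [← div_eq_mul_inv, ENNReal.div_le_iff hr0 hrt] at h5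
  have hne : (𝓝[>] (Metric.ediam s)).NeBot := nhdsGT_neBot_of_exists_gt ⟨_, hlt⟩
  refine ge_of_tendsto (f := fun r => δ * r) (x := 𝓝[>] (Metric.ediam s)) ?_ ?_
  · exact (ENNReal.Tendsto.const_mul tendsto_id (Or.inr hδ)).mono_left nhdsWithin_le_nhds
  · filter_upwards [Ioo_mem_nhdsGT hlt] with r hr using hev r hr

/-- A flow that is asymptotically smaller than the inverse height along every direction has
strength at most an arbitrarily small multiple of the one-dimensional Hausdorff measure. -/
theorem flow_root_le_hausdorff {θ : V → ℝ≥0∞} (hθ : ∀ v, θ v ≤ ∑ c ∈ T.children ρ v, θ c)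
    (htot : ∀ x : T.Direction ρ, x.totalResistance = ∞)
    (hlim : ∀ x : T.Direction ρ,
      Tendsto (fun n => θ (x.vertex n) * x.height n) atTop (𝓝 0))
    {δ : ℝ≥0∞} (h0 : δ ≠ 0) (hδ : δ ≠ ∞) :
    θ ρ ≤ δ * (Measure.hausdorffMeasure 1 : Measure (T.Direction ρ)) Set.univ := by
  let A : ℕ → Set (T.Direction ρ) := fun N =>
    {x | ∀ n, (N : ℝ≥0∞) ≤ x.height n → θ (x.vertex n) * x.height n ≤ δ}
  have hA : ∀ N, MeasurableSet (A N) := by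
    intro N
    have : A N = ⋂ n, {x | (N : ℝ≥0∞) ≤ x.height n → θ (x.vertex n) * x.height n ≤ δ} := by
      ext x; simp [A]
    rw [this]
    refine .iInter fun n => (Direction.isOpen_of_vertex n fun x hx y hxy => ?_).measurableSet
    rw [Set.mem_ofPred_eq] at hx ⊢
    rwa [← Direction.height_eq hxy, ← hxy]
  have hcov : ⋃ N, disjointed A N = Set.univ := by
    rw [iUnion_disjointed, Set.eq_univ_iff_forall]
    intro x
    obtain ⟨m, hm⟩ := eventually_atTop.1 ((hlim x).eventually (ge_mem_nhds (pos_iff_ne_zero.2 h0)))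
    obtain ⟨N, hN⟩ := ENNReal.exists_nat_gt (x.height_ne_top m)
    refine Set.mem_iUnion.2 ⟨N, fun n hn => hm n ?_⟩
    by_contra! hlt
    exact absurd (x.height_mono hlt.le) (not_le.2 (hN.trans_le hn))
  have hpiece : ∀ N, flowMeasure T ρ θ (disjointed A N) ≤
      δ * (Measure.hausdorffMeasure 1 : Measure (T.Direction ρ)) (disjointed A N) := by
    intro N
    have h1 : OuterMeasure.restrict (disjointed A N) (flowMeasure T ρ θ) ≤
        OuterMeasure.mkMetric (δ • fun r : ℝ≥0∞ => r ^ (1 : ℝ)) := by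
      refine OuterMeasure.le_mkMetric _ _ (N + 2 : ℝ≥0∞)⁻¹ (by simp) fun s hs => ?_
      rw [OuterMeasure.restrict_apply]
      simp only [Pi.smul_apply, ENNReal.rpow_one, smul_eq_mul]
      exact flowMeasure_inter_le hδ htot (fun x hx => disjointed_subset A N hx) hs
    rw [OuterMeasure.mkMetric_smul _ hδ h0] at h1
    have h2 := h1 (disjointed A N)
    rw [OuterMeasure.restrict_apply, Set.inter_self] at h2
    rw [Measure.hausdorffMeasure, ← OuterMeasure.coe_mkMetric]
    exact h2
  calc θ ρ ≤ flowMeasure T ρ θ Set.univ := flow_root_le_flowMeasure hθ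
    _ ≤ ∑' N, flowMeasure T ρ θ (disjointed A N) := by
        rw [← hcov]; exact measure_iUnion_le _
    _ ≤ ∑' N, δ * (Measure.hausdorffMeasure 1 : Measure (T.Direction ρ)) (disjointed A N) :=
        ENNReal.tsum_le_tsum hpiece
    _ = _ := by
        rw [ENNReal.tsum_mul_left, ← measure_iUnion (disjoint_disjointed A)
          (fun N => MeasurableSet.disjointed hA N), hcov]

/-! ### Recurrence -/

/-- If the increments of a bounded sequence `u` are those of `H` times `t`, with `H` increasing to
infinity and `t` nonnegative and decreasing, then `t` is `o(1 / H)`. -/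
theorem tendsto_mul_of_bounded_sum {H t u : ℕ → ℝ} (hH : Monotone H) (hHt : Tendsto H atTop atTop)
    (ht : Antitone t) (ht0 : ∀ n, 0 ≤ t n) {B : ℝ} (hu : ∀ n, u n ≤ B)
    (hinc : ∀ n, u (n + 1) = u n + (H (n + 1) - H n) * t (n + 1)) :
    Tendsto (fun n => t n * H n) atTop (𝓝 0) := by
  have hum : Monotone u := monotone_nat_of_le_succ fun n => by
    rw [hinc]
    exact le_add_of_nonneg_right (mul_nonneg (sub_nonneg.2 (hH n.le_succ)) (ht0 _))
  have key : ∀ m n, m ≤ n → (H n - H m) * t n ≤ u n - u m := by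
    intro m n hmn
    induction n, hmn using Nat.le_induction with
    | base => simp
    | succ n hmn ih =>
      rw [hinc]
      have := mul_le_mul_of_nonneg_left (ht n.le_succ) (sub_nonneg.2 (hH hmn))
      linarith
  have hL := tendsto_atTop_ciSup hum ⟨B, by rintro _ ⟨n, rfl⟩; exact hu n⟩
  set L := ⨆ n, u n
  have huL : ∀ n, u n ≤ L := fun n => hum.ge_of_tendsto hL n
  have ht' : Tendsto t atTop (𝓝 0) := by
    have h1 : Tendsto (fun n => (L - u 0) / (H n - H 0)) atTop (𝓝 0) :=
      Tendsto.const_div_atTop (tendsto_atTop_add_const_right _ _ hHt) _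
    refine tendsto_of_tendsto_of_tendsto_of_le_of_le' tendsto_const_nhds h1
      (Eventually.of_forall ht0) ?_
    filter_upwards [hHt.eventually_gt_atTop (H 0)] with n hn
    rw [le_div_iff₀ (sub_pos.2 hn), mul_comm]
    linarith [key 0 n n.zero_le, huL n]
  rw [Metric.tendsto_atTop]
  intro ε hε
  obtain ⟨m, hm⟩ := (hL.eventually (lt_mem_nhds (show L - ε / 2 < L by linarith))).exists
  have h2 : Tendsto (fun n => t n * H m) atTop (𝓝 0) := by simpa using ht'.mul_const (H m)
  obtain ⟨n₀, hn₀⟩ := eventually_atTop.1 ((h2.eventually (gt_mem_nhds (half_pos hε))).and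
    ((hHt.eventually_ge_atTop 0).and (eventually_ge_atTop m)))
  refine ⟨n₀, fun n hn => ?_⟩
  obtain ⟨h3, h4, h5⟩ := hn₀ n hn
  rw [Real.dist_0_eq_abs, abs_of_nonneg (mul_nonneg (ht0 n) h4)]
  linarith [key m n h5, huL n]

open Classical in
/-- The current through the edge from the parent of `v` to `v` under the potential
`avoidAlways ρ`; at the root, where there is no such edge, the total current leaving the root. -/
noncomputable def escapeFlow (T : WeightedTree V) (ρ v : V) : ℝ :=
  if v = ρ then T.lap (T.avoidAlways ρ) ρ
  else (T.avoidAlways ρ v - T.avoidAlways ρ (T.parent ρ v)) / T.len ρ v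

theorem avoidAlways_child {v c : V} (h : c ∈ T.children ρ v) :
    T.avoidAlways ρ c = T.avoidAlways ρ v + T.len ρ c * escapeFlow T ρ c := by
  have h0 := (len_pos h).ne'
  rw [escapeFlow, if_neg (ne_root_of_mem h), parent_of_mem h]
  field_simp
  ring

theorem escapeFlow_eq_sum (v : V) :
    escapeFlow T ρ v = ∑ c ∈ T.children ρ v, escapeFlow T ρ c := by
  by_cases h : v = ρ
  · subst h
    rw [← lap_root_eq fun v c hc => avoidAlways_child hc, escapeFlow, if_pos rfl]
  · have := lap_eq (T := T) (ρ := ρ) (fun v c hc => avoidAlways_child hc) h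
    rw [eq_avg_iff.1 (avoidAlways_eq_avg h)] at this
    linarith

theorem escapeFlow_nonneg_of_mem {v c : V} (h : c ∈ T.children ρ v) : 0 ≤ escapeFlow T ρ c := by
  rw [escapeFlow, if_neg (ne_root_of_mem h), parent_of_mem h]
  exact div_nonneg (sub_nonneg.2 (avoidAlways_parent_le h)) (len_pos h).le

theorem escapeFlow_nonneg (v : V) : 0 ≤ escapeFlow T ρ v := by
  rw [escapeFlow_eq_sum]
  exact Finset.sum_nonneg fun c hc => escapeFlow_nonneg_of_mem hc

theorem tendsto_escapeFlow_mul_height {x : T.Direction ρ} (hx : x.totalResistance = ∞) :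
    Tendsto (fun n => ENNReal.ofReal (escapeFlow T ρ (x.vertex n)) * x.height n) atTop (𝓝 0) := by
  have hH : ∀ n, x.height n = ENNReal.ofReal (T.rootDist ρ (x.vertex n)) := x.height_eq_rootDist
  have hHt : Tendsto (fun n => T.rootDist ρ (x.vertex n)) atTop atTop := by
    rw [← ENNReal.tendsto_ofReal_nhds_top]
    exact (Direction.tendsto_height hx).congr hH
  have := tendsto_mul_of_bounded_sum (H := fun n => T.rootDist ρ (x.vertex n))
    (t := fun n => escapeFlow T ρ (x.vertex n)) (u := fun n => T.avoidAlways ρ (x.vertex n))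
    (monotone_nat_of_le_succ fun n => by
      rw [rootDist_child (x.mem_children n)]
      exact le_add_of_nonneg_right (len_pos (x.mem_children n)).le) hHt
    (antitone_nat_of_succ_le fun n => by
      rw [escapeFlow_eq_sum (x.vertex n)]
      exact Finset.single_le_sum (fun c _ => escapeFlow_nonneg c) (x.mem_children n))
    (fun n => escapeFlow_nonneg _) (fun n => avoidAlways_le_one _ _) (fun n => by
      rw [avoidAlways_child (x.mem_children n), rootDist_child (x.mem_children n)]; ring)
  have h2 := ENNReal.tendsto_ofReal this
  rw [ENNReal.ofReal_zero] at h2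
  refine h2.congr fun n => ?_
  rw [ENNReal.ofReal_mul (escapeFlow_nonneg _), hH]

/-- The walk does not escape from the root if the one-dimensional Hausdorff measure is finite. -/
theorem escape_eq_zero (htot : ∀ x : T.Direction ρ, x.totalResistance = ∞)
    (hfin : (Measure.hausdorffMeasure 1 : Measure (T.Direction ρ)) Set.univ ≠ ∞) :
    T.avg (T.avoidAlways ρ) ρ ≤ 0 := by
  have hle : ENNReal.ofReal (escapeFlow T ρ ρ) = 0 := by
    have h1 : Tendsto (fun δ : ℝ≥0∞ =>
        δ * (Measure.hausdorffMeasure 1 : Measure (T.Direction ρ)) Set.univ) (𝓝[>] 0) (𝓝 0) := by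
      have := ENNReal.Tendsto.mul_const (tendsto_id (α := ℝ≥0∞) (x := 𝓝 0)) (Or.inr hfin)
      simpa using this.mono_left nhdsWithin_le_nhds
    refine le_antisymm (ge_of_tendsto h1 ?_) zero_le
    filter_upwards [Ioo_mem_nhdsGT (zero_lt_one (α := ℝ≥0∞))] with δ hδ
    refine flow_root_le_hausdorff (θ := fun v => ENNReal.ofReal (escapeFlow T ρ v)) (fun v => ?_)
      htot (fun x => tendsto_escapeFlow_mul_height (htot x)) hδ.1.ne' hδ.2.ne_top
    rw [← ENNReal.ofReal_sum_of_nonneg fun c _ => escapeFlow_nonneg c, ← escapeFlow_eq_sum]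
  rw [ENNReal.ofReal_eq_zero, escapeFlow, if_pos rfl] at hle
  rw [avg, avoidAlways_self, zero_add]
  exact mul_nonpos_of_nonneg_of_nonpos (inv_nonneg.2 (tot_nonneg ρ)) hle

end WeightedTree

/-! ### Transience -/

/-- The Hausdorff content `H^d_∞`, for which the diameters of the covering sets are not restricted,
of a space of positive `d`-dimensional Hausdorff measure is positive. -/
theorem boundedBy_ediam_rpow_univ_ne_zero {X : Type*} [EMetricSpace X] [MeasurableSpace X]
    [BorelSpace X] {d : ℝ} (hd : 0 < d)
    (h : (Measure.hausdorffMeasure d : Measure X) Set.univ ≠ 0) :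
    OuterMeasure.boundedBy (fun s : Set X => Metric.ediam s ^ d) Set.univ ≠ 0 := by
  contrapose! h
  rw [Measure.hausdorffMeasure_apply, ← nonpos_iff_eq_zero]
  refine iSup₂_le fun r hr => le_of_forall_pos_le_add fun ε hε => ?_
  rw [zero_add]
  have hη : OuterMeasure.boundedBy (fun s : Set X => Metric.ediam s ^ d) Set.univ <
      min ε (r ^ d) := by
    rw [h]
    exact lt_min hε (ENNReal.rpow_pos_of_nonneg hr hd.le)
  rw [OuterMeasure.boundedBy_apply] at hη
  obtain ⟨t, ht⟩ := iInf_lt_iff.1 hη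
  obtain ⟨htu, hts⟩ := iInf_lt_iff.1 ht
  refine (iInf₂_le t htu).trans ((iInf_le _ fun n => ?_).trans (hts.le.trans (min_le_left _ _)))
  rcases (t n).eq_empty_or_nonempty with he | hne
  · rw [he, Metric.ediam_empty]; exact zero_le
  · have h1 := ENNReal.le_tsum (f := fun n => ⨆ _ : (t n).Nonempty, Metric.ediam (t n) ^ d) n
    have h2 : Metric.ediam (t n) ^ d < r ^ d :=
      ((le_iSup (fun _ : (t n).Nonempty => Metric.ediam (t n) ^ d) hne).trans h1).trans_lt
        (hts.trans_le (min_le_right _ _))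
    exact ((ENNReal.rpow_lt_rpow_iff hd).1 h2).le

/-- The lower Riemann sum bound for `∫ t in A..B, s * t ^ (-(s + 1))` by the value at the right
endpoint. -/
theorem mul_rpow_le_rpow_neg_sub {s A B : ℝ} (hs : 0 ≤ s) (hA : 0 < A) (hAB : A ≤ B) :
    s * (B - A) * B ^ (-(s + 1)) ≤ A ^ (-s) - B ^ (-s) := by
  have hB : 0 < B := hA.trans_le hAB
  have hq : 0 < A / B := div_pos hA hB
  have h1 : 1 + s * (1 - A / B) ≤ (A / B) ^ (-s) := by
    rw [Real.rpow_def_of_pos hq]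
    have h2 := Real.add_one_le_exp (Real.log (A / B) * -s)
    have h3 := mul_le_mul_of_nonneg_left (Real.log_le_sub_one_of_pos hq) hs
    linarith
  have hBs : 0 < B ^ (-s) := Real.rpow_pos_of_pos hB _
  have h4 : A ^ (-s) = (A / B) ^ (-s) * B ^ (-s) := by
    rw [← Real.mul_rpow hq.le hB.le, div_mul_cancel₀ _ hB.ne']
  have h5 : B ^ (-(s + 1)) = B ^ (-s) / B := by
    rw [neg_add, ← sub_eq_add_neg, Real.rpow_sub_one hB.ne']
  rw [h4, h5]
  have h6 := mul_le_mul_of_nonneg_right h1 hBs.le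
  have h7 : s * (B - A) * (B ^ (-s) / B) = s * (1 - A / B) * B ^ (-s) := by
    field_simp
  rw [h7]
  linarith

namespace WeightedTree

open Filter Topology

variable {V : Type*} {T : WeightedTree V} {ρ : V}

/-- The bound `min (1 / h) 1 ^ d` for the directions through a vertex at distance `h` from the root,
in a weaker form without a singularity at `h = 0`. -/
theorem ediam_cyl_rpow_le {d : ℝ} (hd : 0 ≤ d) (v : V) :
    Metric.ediam (T.cyl ρ v) ^ d ≤ ENNReal.ofReal ((2 / (1 + T.rootDist ρ v)) ^ d) := by
  have h0 := rootDist_nonneg (T := T) (ρ := ρ) v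
  rw [← ENNReal.ofReal_rpow_of_nonneg (by positivity) hd]
  refine ENNReal.rpow_le_rpow ((ediam_cyl_le v).trans ?_) hd
  rcases le_total (T.rootDist ρ v) 1 with h | h
  · refine (min_le_right _ _).trans ?_
    rw [ENNReal.one_le_ofReal, le_div_iff₀ (by linarith)]
    linarith
  · have hpos : 0 < T.rootDist ρ v := by linarith
    refine (min_le_left _ _).trans ?_
    rw [← ENNReal.ofReal_inv_of_pos hpos]
    refine ENNReal.ofReal_le_ofReal ?_
    rw [inv_eq_one_div, div_le_div_iff₀ hpos (by linarith)]
    linarith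

/-- A function on the vertices that is at most of order `(1 + h) ^ (-d)` at distance `h` from the
root, for some `d > 1`, is the gradient of a function that is bounded above. The induction compares
the sum along a path with the integral of `(1 + t) ^ (-d)`. -/
theorem pathSum_le {θ : V → ℝ} {d : ℝ} (hd : 1 < d)
    (hθ : ∀ v, θ v ≤ (2 / (1 + T.rootDist ρ v)) ^ d) (v : V) :
    T.pathSum ρ (fun v => T.len ρ v * θ v) v ≤ 2 ^ d / (d - 1) := by
  have hd1 : 0 < d - 1 := sub_pos.2 hd
  have hC : 0 < (2 : ℝ) ^ d / (d - 1) := div_pos (Real.rpow_pos_of_pos two_pos _) hd1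
  have key : T.pathSum ρ (fun v => T.len ρ v * θ v) v ≤
      2 ^ d / (d - 1) * (1 - (1 + T.rootDist ρ v) ^ (-(d - 1))) := by
    induction v using root_induction (T := T) (ρ := ρ) with
    | h0 => simp [pathSum_root, rootDist_root]
    | hs v c hc ih =>
      have hv0 := rootDist_nonneg (T := T) (ρ := ρ) v
      have hc0 := rootDist_nonneg (T := T) (ρ := ρ) c
      have hl := len_pos hc
      have hcd := rootDist_child hc
      have h1 := mul_rpow_le_rpow_neg_sub (s := d - 1) (A := 1 + T.rootDist ρ v)
        (B := 1 + T.rootDist ρ c) hd1.le (by linarith) (by linarith)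
      have h2 : T.len ρ c * θ c ≤ 2 ^ d / (d - 1) *
          ((1 + T.rootDist ρ v) ^ (-(d - 1)) - (1 + T.rootDist ρ c) ^ (-(d - 1))) := by
        calc T.len ρ c * θ c ≤ T.len ρ c * (2 / (1 + T.rootDist ρ c)) ^ d :=
              mul_le_mul_of_nonneg_left (hθ c) hl.le
          _ = 2 ^ d / (d - 1) * ((d - 1) * (1 + T.rootDist ρ c - (1 + T.rootDist ρ v)) *
                (1 + T.rootDist ρ c) ^ (-(d - 1 + 1))) := by
              rw [Real.div_rpow zero_le_two (by linarith), sub_add_cancel,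
                Real.rpow_neg (by linarith), hcd]
              field_simp
              ring
          _ ≤ _ := mul_le_mul_of_nonneg_left h1 hC.le
      rw [pathSum_child _ hc]
      linarith
  refine key.trans (mul_le_of_le_one_right hC.le ?_)
  linarith [Real.rpow_nonneg (show 0 ≤ 1 + T.rootDist ρ v by
    linarith [rootDist_nonneg (T := T) (ρ := ρ) v]) (-(d - 1))]

/-- The walk escapes from the root if some Hausdorff measure of dimension greater than one does not
vanish: the gradient of the potential `u` below is the Hausdorff content. -/
theorem escape_pos_of_hausdorffMeasure_ne_zero {d : ℝ} (hd : 1 < d)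
    (h : (Measure.hausdorffMeasure d : Measure (T.Direction ρ)) Set.univ ≠ 0) :
    0 < T.avg (T.avoidAlways ρ) ρ := by
  have hd0 : 0 < d := by linarith
  let κ : OuterMeasure (T.Direction ρ) := OuterMeasure.boundedBy fun s => Metric.ediam s ^ d
  have hκ : ∀ v, κ (T.cyl ρ v) ≤ ENNReal.ofReal ((2 / (1 + T.rootDist ρ v)) ^ d) := fun v =>
    (OuterMeasure.boundedBy_le _).trans (ediam_cyl_rpow_le hd0.le v)
  have hκt : ∀ v, κ (T.cyl ρ v) ≠ ∞ := fun v => ((hκ v).trans_lt ENNReal.ofReal_lt_top).ne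
  let θ : V → ℝ := fun v => (κ (T.cyl ρ v)).toReal
  have hθ : ∀ v, θ v ≤ (2 / (1 + T.rootDist ρ v)) ^ d := fun v =>
    ENNReal.toReal_le_of_le_ofReal (Real.rpow_nonneg
      (div_nonneg zero_le_two (by linarith [rootDist_nonneg (T := T) (ρ := ρ) v])) _) (hκ v)
  have hθs : ∀ v, θ v ≤ ∑ c ∈ T.children ρ v, θ c := by
    intro v
    rw [← ENNReal.toReal_sum fun c _ => hκt c]
    refine ENNReal.toReal_mono (ENNReal.sum_ne_top.2 fun c _ => hκt c) ?_
    exact (measure_mono (cyl_subset v)).trans (measure_biUnion_finset_le _ _)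
  have hθρ : 0 < θ ρ := by
    refine ENNReal.toReal_pos ?_ (hκt ρ)
    rw [cyl_root]
    exact boundedBy_ediam_rpow_univ_ne_zero hd0 h
  set C : ℝ := 2 ^ d / (d - 1)
  have hC : 0 < C := div_pos (Real.rpow_pos_of_pos two_pos _) (sub_pos.2 hd)
  let u : V → ℝ := fun v => T.pathSum ρ (fun v => T.len ρ v * θ v) v / C
  have hu : ∀ v, ∀ c ∈ T.children ρ v, u c = u v + T.len ρ c * (θ c / C) := by
    intro v c hc
    simp only [u, pathSum_child _ hc]
    ring
  have hu1 : ∀ v, u v ≤ 1 := fun v => (div_le_one hC).2 (pathSum_le hd hθ v)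
  have hu0 : u ρ = 0 := by simp [u, pathSum_root]
  have hsub : ∀ v, v ≠ ρ → u v ≤ T.avg u v := by
    intro v hv
    rw [le_avg_iff, lap_eq hu hv, ← Finset.sum_div, ← sub_div]
    exact div_nonneg (sub_nonneg.2 (hθs v)) hC.le
  have hlap : 0 < T.lap u ρ := by
    rw [lap_root_eq hu, ← Finset.sum_div]
    exact div_pos (hθρ.trans_le (hθs ρ)) hC
  have hnb : (T.nbr ρ).Nonempty := by
    by_contra hne
    rw [Finset.not_nonempty_iff_eq_empty] at hne
    simp [lap, hne] at hlap
  calc 0 < T.avg u ρ := by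
        rw [avg, hu0, zero_add]
        exact mul_pos (inv_pos.2 (tot_pos_iff.2 hnb)) hlap
    _ ≤ _ := avg_mono (le_avoidAlways hu1 hu0 hsub) ρ

end WeightedTree

theorem theorem1p12 {V : Type*} [Countable V] [MeasurableSpace V] [DiscreteMeasurableSpace V]
    (T : WeightedTree V) (ρ : V)
    (hT : ∀ x : T.Direction ρ, x.totalResistance = ∞) :
    (IsFiniteMeasure (Measure.hausdorffMeasure 1 : Measure (T.Direction ρ)) → T.IsRecurrent) ∧
      (1 < dimH (Set.univ : Set (T.Direction ρ)) → T.IsTransient) := by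
  constructor
  · intro hfin
    rw [WeightedTree.isRecurrent_iff]
    intro x
    by_contra! hx
    exact absurd (WeightedTree.escape_pos_of_escape_pos hx ρ)
      (not_lt.2 (WeightedTree.escape_eq_zero hT (measure_ne_top _ _)))
  · intro hdim
    rw [WeightedTree.isTransient_iff]
    obtain ⟨d, hd1, hd2⟩ := ENNReal.lt_iff_exists_nnreal_btwn.1 hdim
    refine WeightedTree.escape_pos_of_escape_pos (x := ρ)
      (WeightedTree.escape_pos_of_hausdorffMeasure_ne_zero (d := d) (by exact_mod_cast hd1) ?_)
    rw [hausdorffMeasure_of_lt_dimH hd2]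
    exact ENNReal.top_ne_zero
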